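/- Let $k$ and $l$ be distinct positive integers, and let $G$ be a finite abelian group, written additively, of order $n$ and exponent $v$ (the largest order of an element of $G$). For a subset $A$ of a finite abelian group and a positive integer $h$, let $hA$ denote the set of all sums of $h$ (not necessarily distinct) elements of $A$; call $A$ $(k,l)$-sum-free if $kA \cap lA = \emptyset$, and let $\lambda_{k,l}(G)$ be the maximum size of a $(k,l)$-sum-free subset of $G$. For a positive integer $d$ set $\delta(d) = \gcd(d, k-l)$. If $v$ has at least one positive divisor $d$ that is not congruent modulo $k+l$ to any integer $j$ with $1 \le j \le \delta(d)$, then $$\lambda_{k,l}(G) = \lambda_{k,l}(\mathbb{Z}_v)\cdot \frac{n}{v}.$$ -/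

import Mathlib

/-- The `h`-fold sumset `hA`: all sums of `h` (not necessarily distinct) elements of `A`. -/
def hFoldSumset {G : Type*} [AddCommGroup G] (h : ℕ) (A : Set G) : Set G :=
  {x | ∃ f : Fin h → G, (∀ i, f i ∈ A) ∧ ∑ i, f i = x}

/-- `A` is `(k,l)`-sum-free: `kA ∩ lA = ∅`. -/
def IsSumFreeKL {G : Type*} [AddCommGroup G] (k l : ℕ) (A : Set G) : Prop :=
  hFoldSumset k A ∩ hFoldSumset l A = ∅

/-- `λ_{k,l}(G)`: the maximum size of a `(k,l)`-sum-free subset of `G`. For a finite group `G`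
and `k, l ≥ 1`, the set of sizes is bounded by the order of `G` and contains `0`, so this supremum
is a maximum. -/
noncomputable def maxSumFreeKL (k l : ℕ) (G : Type*) [AddCommGroup G] : ℕ :=
  sSup {m : ℕ | ∃ A : Finset G, IsSumFreeKL k l (A : Set G) ∧ A.card = m}

/-- `δ(d) = gcd(d, k - l)`, with `k - l` taken as an integer. -/
def deltaKL (k l d : ℕ) : ℕ :=
  Int.gcd (d : ℤ) ((k : ℤ) - (l : ℤ))

/-! Compare densities: the claim is that G and its largest cyclic quotient ℤ_v have the same maximal
density. Preimages under surjections of sum-free sets are sum-free, so passing to a quotient never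
raises the maximal density; this gives one inequality.

For the other, let B be a maximum sum-free set. If #B ≤ n/(k+l), the hypothesis on d makes an
interval in ℤ_d of density at least 1/(k+l) sum-free, and ℤ_v does at least as well
(`le_mul_maxSumFreeKL_zmod`). If #B > n/(k+l), some cyclic quotient of G maps B to a sum-free set
(`exists_zmod_isSumFreeKL_image`), whose density is no smaller.

The cyclic quotient comes from induction on the order of G. With k > l, put T = kB - lB, so 0 ∉ T.
If a nonzero subgroup H misses T, then B stays sum-free in G/H. If every nonzero subgroup meets T
and #B ≥ 2, then G is cyclic (`isAddCyclic_of_forall_exists_mem_sumDiff`): B cannot nearly fill its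
cosets of a nonzero subgroup, so Hamidoune's isoperimetric method gives Mann- and Vosper-type growth
of sumsets, and in a noncyclic G the set T would be too large to avoid 0. -/

open scoped Pointwise
open Finset

/-! ### Subgroups of a finite abelian group as finsets. -/

section Subgroup

variable {G : Type*} [AddCommGroup G] [Fintype G]

/-- The elements of a subgroup as a finset. -/
noncomputable def AddSubgroup.elems (H : AddSubgroup G) : Finset G := by
  classical exact univ.filter (· ∈ H)

@[simp] theorem AddSubgroup.mem_elems {H : AddSubgroup G} {x : G} : x ∈ H.elems ↔ x ∈ H := by
  simp [AddSubgroup.elems]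

theorem AddSubgroup.card_elems_mul_index (H : AddSubgroup G) :
    #H.elems * H.index = Fintype.card G := by
  classical
  have : #H.elems = Nat.card H := by
    rw [Nat.card_eq_fintype_card, Fintype.card_subtype, AddSubgroup.elems]
  rw [this, AddSubgroup.card_mul_index, Nat.card_eq_fintype_card]

theorem AddSubgroup.one_lt_card_elems {H : AddSubgroup G} (h : H ≠ ⊥) : 1 < #H.elems := by
  obtain ⟨x, hx, hx0⟩ := H.bot_or_exists_ne_zero.resolve_left h
  exact one_lt_card.2 ⟨x, by simpa using hx, 0, by simp, hx0⟩

theorem AddSubgroup.two_mul_card_elems_le {H : AddSubgroup G} (h : H ≠ ⊤) :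
    2 * #H.elems ≤ Fintype.card G := by
  have h1 : H.index ≠ 1 := by simpa using h
  have h2 := H.card_elems_mul_index
  have h3 : H.index ≠ 0 := by
    intro h0
    rw [h0, mul_zero] at h2
    exact Fintype.card_ne_zero h2.symm
  have h4 : 2 ≤ H.index := by omega
  nlinarith

end Subgroup

/-! ### Atoms and their intersection property. -/

section Isoperimetric

variable {G : Type*} [AddCommGroup G] [Fintype G] [DecidableEq G]

/-- `X` is `k`-separable for `B`: both `X` and the complement of `X + B` have at least `k`
elements. -/
def SumSeparable (k : ℕ) (B X : Finset G) : Prop :=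
  k ≤ #X ∧ #(X + B) + k ≤ Fintype.card G

/-- A `k`-atom of `B`: a `k`-separable set which minimizes `#(X + B) - #X`, of smallest size among
these. -/
structure IsAtomOf (k : ℕ) (B M : Finset G) : Prop where
  sep : SumSeparable k B M
  le : ∀ X, SumSeparable k B X → #(M + B) + #X ≤ #(X + B) + #M
  min : ∀ X, SumSeparable k B X → #(X + B) + #M ≤ #(M + B) + #X → #M ≤ #X

theorem exists_isAtomOf {k : ℕ} {B X : Finset G} (hX : SumSeparable k B X) :
    ∃ M, IsAtomOf k B M := by
  classical
  obtain ⟨Y, hY, hYmin⟩ := Finset.exists_min_image (univ.filter (SumSeparable k B))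
    (fun X => (#(X + B) : ℤ) - #X) ⟨X, by simpa using hX⟩
  obtain ⟨M, hM, hMmin⟩ := Finset.exists_min_image
    (univ.filter fun X => SumSeparable k B X ∧ (#(X + B) : ℤ) - #X ≤ (#(Y + B) : ℤ) - #Y)
    (fun X => #X) ⟨Y, by simpa using hY⟩
  simp only [mem_filter, mem_univ, true_and] at hY hYmin hM hMmin
  refine ⟨M, hM.1, fun X hX => ?_, fun X hX h => hMmin X ⟨hX, ?_⟩⟩
  · have := hYmin X hX
    omega
  · omega

theorem SumSeparable.vadd {k : ℕ} {B X : Finset G} (h : SumSeparable k B X) (g : G) :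
    SumSeparable k B (g +ᵥ X) := by
  simpa [SumSeparable, vadd_add_assoc, card_vadd_finset] using h

theorem IsAtomOf.vadd {k : ℕ} {B M : Finset G} (h : IsAtomOf k B M) (g : G) :
    IsAtomOf k B (g +ᵥ M) := by
  refine ⟨h.sep.vadd g, fun X hX => ?_, fun X hX => ?_⟩
  · simpa [vadd_add_assoc, card_vadd_finset] using h.le X hX
  · simpa [vadd_add_assoc, card_vadd_finset] using h.min X hX

/-- Duality: the reflected complement D of M + B is again separable and does no worse than M, so
minimality of the atom gives #M ≤ #D. -/
theorem IsAtomOf.card_add_card_add_le {k : ℕ} {B M : Finset G} (h : IsAtomOf k B M) :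
    #M + #(M + B) ≤ Fintype.card G := by
  set D : Finset G := -(M + B)ᶜ with hD
  have hDc : #D + #(M + B) = Fintype.card G := by
    rw [hD, card_neg, card_compl]
    have := card_le_univ (M + B)
    omega
  have hsub : D + B ⊆ -Mᶜ := by
    intro z hz
    obtain ⟨d, hd, b, hb, rfl⟩ := mem_add.1 hz
    rw [hD, mem_neg'] at hd
    rw [mem_neg', mem_compl]
    intro hM
    refine (mem_compl.1 hd) (mem_add.2 ⟨_, hM, b, hb, by abel⟩)
  have hle : #(D + B) + #M ≤ Fintype.card G := by
    have h1 := card_le_card hsub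
    rw [card_neg, card_compl] at h1
    have := card_le_univ M
    omega
  have hs : SumSeparable k B D := by
    obtain ⟨h1, h2⟩ := h.sep
    constructor <;> omega
  have := h.min D hs (by omega)
  omega

/-- The function X ↦ #(X + B) - #X is submodular, so if M ∩ N and M ∪ N are both separable, M ∩ N is
also a minimizer, and minimal size forces M = M ∩ N = N. The union is separable because #M + #(M +
B) is at most the order of G. -/
theorem IsAtomOf.eq_of_card_inter {k : ℕ} {B M N : Finset G}
    (hM : IsAtomOf k B M) (hN : IsAtomOf k B N) (h : k ≤ #(M ∩ N)) : M = N := by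
  have hsubm : #((M ∩ N) + B) + #((M ∪ N) + B) ≤ #(M + B) + #(N + B) := by
    rw [union_add]
    have h1 := card_union_add_card_inter (M + B) (N + B)
    have h2 : #((M ∩ N) + B) ≤ #((M + B) ∩ (N + B)) := card_le_card inter_add_subset
    omega
  have hc := card_union_add_card_inter M N
  have hMN := hM.le N hN.sep
  have hNM := hN.le M hM.sep
  have hMN' := hM.min N hN.sep hNM
  have hNM' := hN.min M hM.sep hMN
  have hMd := hM.card_add_card_add_le
  have hi : SumSeparable k B (M ∩ N) := by
    refine ⟨h, ?_⟩
    have := card_le_card (add_subset_add (inter_subset_left : M ∩ N ⊆ M) (Subset.refl B))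
    have := hM.sep.2
    omega
  have hil := hM.le _ hi
  have hu : SumSeparable k B (M ∪ N) := by
    refine ⟨h.trans (card_le_card (inter_subset_left.trans subset_union_left)), ?_⟩
    omega
  have hul := hM.le _ hu
  have := hM.min _ hi (by omega)
  have h1 : M ∩ N = M := eq_of_subset_of_card_le inter_subset_left this
  have h2 : M ∩ N = N := eq_of_subset_of_card_le inter_subset_right (by omega)
  rw [← h1, h2]

end Isoperimetric

/-! ### 1-atoms are subgroups: Mann-type bounds. -/

section Isoperimetric

variable {G : Type*} [AddCommGroup G] [Fintype G] [DecidableEq G]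

theorem exists_elems_eq_of_vadd_eq {M : Finset G} (h0 : 0 ∈ M) (h : ∀ x ∈ M, -x +ᵥ M = M) :
    ∃ H : AddSubgroup G, H.elems = M := by
  have hsub : ∀ x ∈ M, ∀ y ∈ M, -x + y ∈ M := by
    intro x hx y hy
    have : -x +ᵥ y ∈ -x +ᵥ M := vadd_mem_vadd_finset hy
    rwa [h x hx, vadd_eq_add] at this
  have hneg : ∀ x ∈ M, -x ∈ M := fun x hx => by simpa using hsub x hx 0 h0
  refine ⟨{ carrier := M, zero_mem' := h0, add_mem' := ?_, neg_mem' := fun {x} hx => hneg x hx },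
    by ext; simp [← AddSubgroup.mem_carrier]⟩
  intro x y hx hy
  simpa using hsub _ (hneg x hx) y hy

/-- Translates of a 1-atom coincide as soon as they meet, so a 1-atom containing 0 is a subgroup,
and it inherits the deficiency of X. -/
theorem card_add_lt_of_isAtomOf_one {B X : Finset G} (hX : X.Nonempty) (hXB : X + B ≠ univ)
    (h : #(X + B) + 1 < #X + #B) :
    ∃ H : AddSubgroup G, H ≠ ⊥ ∧ H.elems + B ≠ univ ∧ #(H.elems + B) + 1 < #H.elems + #B := by
  have hlt : #(X + B) < Fintype.card G := card_lt_univ_of_notMem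
    (x := (not_forall.1 fun h => hXB (eq_univ_iff_forall.2 h)).choose)
    (not_forall.1 fun h => hXB (eq_univ_iff_forall.2 h)).choose_spec
  have hs : SumSeparable 1 B X := ⟨hX.card_pos, by omega⟩
  obtain ⟨M, hM⟩ := exists_isAtomOf hs
  obtain ⟨m, hm⟩ : M.Nonempty := card_pos.1 hM.sep.1
  have hN := hM.vadd (-m)
  set N := -m +ᵥ M with hNdef
  have h0 : (0 : G) ∈ N := mem_vadd_finset.2 ⟨m, hm, by simp⟩
  obtain ⟨H, hH⟩ := exists_elems_eq_of_vadd_eq h0 fun x hx =>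
    (hN.vadd (-x)).eq_of_card_inter hN
      (card_pos.2 ⟨0, mem_inter.2 ⟨mem_vadd_finset.2 ⟨x, hx, by simp⟩, h0⟩⟩)
  have h1 := hN.le X hs
  have h2 := hN.sep.2
  rw [← hH] at h1 h2
  refine ⟨H, ?_, ?_, by omega⟩
  · rintro rfl
    have : (⊥ : AddSubgroup G).elems = {0} := by ext; simp
    rw [this] at h1
    simp at h1
    omega
  · intro h
    rw [h, card_univ] at h2
    omega

/-- The elements of `X` in the coset `x + K`. -/
noncomputable def cosetPart (K : AddSubgroup G) (x : G) (X : Finset G) : Finset G := by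
  classical exact X.filter (fun y => y - x ∈ K)

theorem mem_cosetPart {K : AddSubgroup G} {x y : G} {X : Finset G} :
    y ∈ cosetPart K x X ↔ y ∈ X ∧ y - x ∈ K := by
  simp [cosetPart]

theorem cosetPart_subset {K : AddSubgroup G} {x : G} {X : Finset G} : cosetPart K x X ⊆ X :=
  fun _ hy => (mem_cosetPart.1 hy).1

theorem card_cosetPart_add {K : AddSubgroup G} {x : G} {X A : Finset G} (hA : A ⊆ K.elems) :
    #(cosetPart K x X + A) + #(X \ cosetPart K x X + A) = #(X + A) := by
  rw [← card_union_of_disjoint, ← union_add, union_sdiff_of_subset cosetPart_subset]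
  rw [disjoint_left]
  intro z hz hz'
  obtain ⟨y, hy, a, ha, rfl⟩ := mem_add.1 hz
  obtain ⟨y', hy', a', ha', h⟩ := mem_add.1 hz'
  rw [mem_sdiff] at hy'
  refine hy'.2 (mem_cosetPart.2 ⟨hy'.1, ?_⟩)
  have h1 := (mem_cosetPart.1 hy).2
  have h2 := AddSubgroup.mem_elems.1 (hA ha)
  have h3 := AddSubgroup.mem_elems.1 (hA ha')
  have : y' - x = (y - x) + a - a' := by
    rw [eq_sub_of_add_eq h]; abel
  rw [this]
  exact sub_mem (add_mem h1 h2) h3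

theorem card_vadd_elems (K : AddSubgroup G) (x : G) : #(x +ᵥ K.elems) = #K.elems :=
  card_vadd_finset _ _

theorem cosetPart_subset_vadd {K : AddSubgroup G} {x : G} {X : Finset G} :
    cosetPart K x X ⊆ x +ᵥ K.elems := fun y hy =>
  mem_vadd_finset.2 ⟨y - x, by simpa using (mem_cosetPart.1 hy).2, by simp⟩

theorem cosetPart_add_elems_subset {K : AddSubgroup G} {x : G} {X : Finset G} :
    cosetPart K x X + K.elems ⊆ x +ᵥ K.elems := by
  intro z hz
  obtain ⟨y, hy, a, ha, rfl⟩ := mem_add.1 hz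
  refine mem_vadd_finset.2 ⟨y - x + a, ?_, by rw [vadd_eq_add]; abel⟩
  exact AddSubgroup.mem_elems.2 (add_mem (mem_cosetPart.1 hy).2 (by simpa using ha))

/-- Some coset of K meets X but is not filled by X + A. The other cosets lose nothing since 0 ∈ A,
so the whole deficiency sits in that coset, and `card_add_lt_of_isAtomOf_one` applies inside K. -/
theorem exists_card_add_le_of_card_add_lt {A X : Finset G} {K : AddSubgroup G}
    (hK : AddSubgroup.closure (A : Set G) = K) (h0 : 0 ∈ A)
    (hne : X + A ≠ X + K.elems) (hlt : #(X + A) + 1 < #X + #A) :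
    ∃ N : AddSubgroup G, N ≠ ⊥ ∧ ¬ A ⊆ N.elems ∧ #(N.elems + A) + 1 < #N.elems + #A := by
  classical
  have hA : A ⊆ K.elems := fun a ha => by
    rw [AddSubgroup.mem_elems, ← hK]; exact AddSubgroup.subset_closure ha
  obtain ⟨y, hy, hyA⟩ : ∃ y ∈ X + K.elems, y ∉ X + A := by
    by_contra! h
    exact hne (Subset.antisymm (add_subset_add_left hA) h)
  obtain ⟨x, hx, c, hc, rfl⟩ := mem_add.1 hy
  have hsplit := card_cosetPart_add (x := x) (X := X) hA
  have hrest : #(X \ cosetPart K x X) ≤ #(X \ cosetPart K x X + A) :=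
    card_le_card_add_right ⟨0, h0⟩
  have hX := card_sdiff_add_card_eq_card (cosetPart_subset (K := K) (x := x) (X := X))
  set Y : Finset K := univ.filter fun z => x + (z : G) ∈ X with hY
  set A' : Finset K := univ.filter fun z => (z : G) ∈ A with hA'
  have hinj : Function.Injective (K.subtype) := K.subtype_injective
  have himA : A'.image K.subtype = A := by
    ext a
    simp only [hA', mem_image, mem_filter, mem_univ, true_and, AddSubgroup.subtype_apply]
    exact ⟨by rintro ⟨z, hz, rfl⟩; exact hz,
      fun ha => ⟨⟨a, AddSubgroup.mem_elems.1 (hA ha)⟩, ha, rfl⟩⟩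
  have himY : x +ᵥ Y.image K.subtype = cosetPart K x X := by
    ext a
    simp only [hY, mem_vadd_finset, mem_image, mem_filter, mem_univ, true_and,
      AddSubgroup.subtype_apply, mem_cosetPart, vadd_eq_add]
    constructor
    · rintro ⟨_, ⟨z, hz, rfl⟩, rfl⟩
      exact ⟨hz, by simp⟩
    · rintro ⟨ha, ha'⟩
      exact ⟨a - x, ⟨⟨a - x, ha'⟩, by simpa using ha, rfl⟩, by simp⟩
  have hcA : #A' = #A := by rw [← himA, card_image_of_injective _ hinj]
  have hcY : #Y = #(cosetPart K x X) := by
    rw [← himY, card_vadd_finset, card_image_of_injective _ hinj]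
  have hcYA : #(Y + A') = #(cosetPart K x X + A) := by
    rw [← himY, vadd_add_assoc, card_vadd_finset, ← himA, ← image_add,
      card_image_of_injective _ hinj]
  obtain ⟨H, hHbot, hHu, hHc⟩ := card_add_lt_of_isAtomOf_one (B := A') (X := Y)
    ⟨0, by simpa [hY] using hx⟩
    (by
      intro h
      have : (⟨c, AddSubgroup.mem_elems.1 hc⟩ : K) ∈ Y + A' := h ▸ mem_univ _
      obtain ⟨z, hz, a, ha, hza⟩ := mem_add.1 this
      have hza' : (z : G) + a = c := congrArg Subtype.val hza
      refine hyA (mem_add.2 ⟨x + z, (mem_filter.1 hz).2, a, (mem_filter.1 ha).2, ?_⟩)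
      rw [add_assoc, hza'])
    (by omega)
  have himH : H.elems.image K.subtype = (H.map K.subtype).elems := by
    ext a
    simp
  refine ⟨H.map K.subtype, ?_, ?_, ?_⟩
  · simpa [AddSubgroup.map_eq_bot_iff_of_injective _ hinj] using hHbot
  · intro hsub
    apply hHu
    have hle : K ≤ H.map K.subtype := by
      refine hK.symm.le.trans ((AddSubgroup.closure_le _).2 fun a ha => ?_)
      exact AddSubgroup.mem_elems.1 (hsub ha)
    refine eq_univ_iff_forall.2 fun z => mem_add.2 ⟨z, ?_, 0, by simpa [hA'] using h0, by simp⟩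
    obtain ⟨w, hw, hwz⟩ := hle z.2
    rw [AddSubgroup.mem_elems]
    rwa [hinj hwz] at hw
  · rw [← himH, ← himA, ← image_add, card_image_of_injective _ hinj,
      card_image_of_injective _ hinj, card_image_of_injective _ hinj]
    exact hHc

/-- A set of generators which fills cosets of subgroups badly has large sumsets. -/
theorem card_add_card_le_of_forall {A X : Finset G} {K : AddSubgroup G}
    (hK : AddSubgroup.closure (A : Set G) = K) (h0 : 0 ∈ A)
    (hN : ∀ N : AddSubgroup G, N ≠ ⊥ → ¬ A ⊆ N.elems → #N.elems + #A ≤ #(N.elems + A) + 1)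
    (hne : X + A ≠ X + K.elems) : #X + #A ≤ #(X + A) + 1 := by
  by_contra! h
  obtain ⟨N, h1, h2, h3⟩ := exists_card_add_le_of_card_add_lt hK h0 hne h
  have := hN N h1 h2
  omega

/-- At most one coset of K meeting S can be left unfilled by S + A: growth by #A - 1 in one coset
uses up the allowed excess, and growth elsewhere would exceed it since #A ≥ 2. -/
theorem card_add_elems_le_of_forall {A S : Finset G} {K : AddSubgroup G}
    (hK : AddSubgroup.closure (A : Set G) = K) (h0 : 0 ∈ A) (hA2 : 2 ≤ #A)
    (hN : ∀ N : AddSubgroup G, N ≠ ⊥ → ¬ A ⊆ N.elems → #N.elems + #A ≤ #(N.elems + A) + 1)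
    (hS : #(S + A) + 1 ≤ #S + #A) : #(S + K.elems) + 1 ≤ #S + #K.elems := by
  have hA : A ⊆ K.elems := fun a ha => by
    rw [AddSubgroup.mem_elems, ← hK]; exact AddSubgroup.subset_closure ha
  have hAK := card_le_card hA
  by_cases hne : S + A = S + K.elems
  · rw [← hne]; omega
  obtain ⟨y, hy, hyA⟩ : ∃ y ∈ S + K.elems, y ∉ S + A := by
    by_contra! h
    exact hne (Subset.antisymm (add_subset_add_left hA) h)
  obtain ⟨x, hx, c, hc, rfl⟩ := mem_add.1 hy
  have hsplit := card_cosetPart_add (x := x) (X := S) hA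
  have hsplitK := card_cosetPart_add (x := x) (X := S) (Subset.refl K.elems)
  have hc' := card_sdiff_add_card_eq_card (cosetPart_subset (K := K) (x := x) (X := S))
  have hxp : x ∈ cosetPart K x S := mem_cosetPart.2 ⟨hx, by simp⟩
  have h1 := card_add_card_le_of_forall (X := cosetPart K x S) hK h0 hN (by
    intro h
    exact hyA (add_subset_add_right cosetPart_subset (h ▸ add_mem_add hxp hc)))
  have h1' : #A ≤ #(cosetPart K x S + A) := card_le_card_add_left ⟨x, hxp⟩
  have h2 := card_le_card (cosetPart_add_elems_subset (K := K) (x := x) (X := S))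
  rw [card_vadd_elems] at h2
  by_cases h3 : S \ cosetPart K x S + A = S \ cosetPart K x S + K.elems
  · rw [← h3] at hsplitK
    omega
  · have := card_add_card_le_of_forall hK h0 hN h3
    omega

end Isoperimetric

/-! ### 2-atoms: a Vosper-type theorem. -/

section Isoperimetric

variable {G : Type*} [AddCommGroup G] [Fintype G] [DecidableEq G]

/-- `M` meets each of its proper translates in at most one element. -/
def IsSidonLike (M : Finset G) : Prop :=
  ∀ x : G, x ≠ 0 → #(M ∩ (x +ᵥ M)) ≤ 1

/-- If M meets x + M twice with x ≠ 0, then x is a period of M. For y ∈ M, both 0 and x then lie in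
M ∩ (-y + M), so every such translate equals M. -/
theorem IsAtomOf.isSidonLike_or_exists_elems_eq {B M : Finset G} (hM : IsAtomOf 2 B M)
    (h0 : 0 ∈ M) : IsSidonLike M ∨ ∃ H : AddSubgroup G, H.elems = M := by
  by_cases hs : IsSidonLike M
  · exact Or.inl hs
  right
  simp only [IsSidonLike, not_forall, not_le] at hs
  obtain ⟨x, hx0, hx⟩ := hs
  have hxM : M = x +ᵥ M := hM.eq_of_card_inter (hM.vadd x) hx
  have hper : ∀ y ∈ M, x + y ∈ M := fun y hy => by
    rw [hxM]; exact vadd_mem_vadd_finset hy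
  refine exists_elems_eq_of_vadd_eq h0 fun y hy => (hM.vadd (-y)).eq_of_card_inter hM ?_
  refine one_lt_card.2 ⟨x, ?_, 0, ?_, hx0⟩
  · refine mem_inter.2 ⟨mem_vadd_finset.2 ⟨x + y, hper y hy, by simp⟩, by simpa using hper 0 h0⟩
  · exact mem_inter.2 ⟨mem_vadd_finset.2 ⟨y, hy, by simp⟩, h0⟩

/-- Bonferroni for the translates x + M, which pairwise share at most one point. -/
theorem IsSidonLike.card_add {M : Finset G} (hM : IsSidonLike M) (X : Finset G) :
    2 * (#X * #M) ≤ 2 * #(X + M) + #X * (#X - 1) := by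
  induction X using Finset.induction_on with
  | empty => simp
  | insert y X hy ih =>
    have hint : #((y +ᵥ M) ∩ (X + M)) ≤ #X := by
      have : (y +ᵥ M) ∩ (X + M) ⊆ X.biUnion fun x => (y +ᵥ M) ∩ (x +ᵥ M) := by
        intro z hz
        obtain ⟨hz1, hz2⟩ := mem_inter.1 hz
        obtain ⟨x, hx, m, hm, rfl⟩ := mem_add.1 hz2
        exact mem_biUnion.2 ⟨x, hx, mem_inter.2 ⟨hz1, mem_vadd_finset.2 ⟨m, hm, rfl⟩⟩⟩
      refine (card_le_card this).trans (card_biUnion_le.trans ?_)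
      refine (sum_le_card_nsmul _ _ 1 fun x hx => ?_).trans (by simp)
      have hne : x - y ≠ 0 := by
        intro h
        rw [sub_eq_zero] at h
        exact hy (h ▸ hx)
      have h1 := hM _ hne
      rw [← card_vadd_finset y, vadd_finset_inter, vadd_vadd, add_sub_cancel] at h1
      exact h1
    have hu := card_union_add_card_inter (y +ᵥ M) (X + M)
    rw [card_vadd_finset, ← singleton_vadd, vadd_eq_add, ← union_add, ← insert_eq] at hu
    rw [← singleton_vadd, vadd_eq_add] at hint
    rw [card_insert_of_notMem hy]
    rcases Nat.eq_zero_or_pos #X with h0 | h0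
    · simp only [h0] at *
      omega
    · obtain ⟨t, ht⟩ : ∃ t, #X = t + 1 := ⟨#X - 1, by omega⟩
      simp only [ht, Nat.add_sub_cancel] at ih hint ⊢
      nlinarith

/-- Two elements of `B` in different cosets of a subgroup `N` such that `N + B` is small lie in
cosets which `B` fills well. -/
theorem card_lt_card_cosetPart_add {B : Finset G} {N : AddSubgroup G}
    (hN : #(N.elems + B) + 1 ≤ #N.elems + #B) {f e : G} (hf : f ∈ B) (he : e ∈ B)
    (hfe : f - e ∉ N) : #N.elems < #(cosetPart N f B) + #(cosetPart N e B) := by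
  have hsub : ∀ {x}, x ∈ B → x +ᵥ N.elems ⊆ N.elems + B := fun {x} hx z hz => by
    obtain ⟨c, hc, rfl⟩ := mem_vadd_finset.1 hz
    exact mem_add.2 ⟨c, hc, x, hx, add_comm _ _⟩
  have hdisj : Disjoint (f +ᵥ N.elems) (e +ᵥ N.elems) := by
    rw [disjoint_left]
    intro z hz hz'
    obtain ⟨c, hc, rfl⟩ := mem_vadd_finset.1 hz
    obtain ⟨c', hc', h⟩ := mem_vadd_finset.1 hz'
    rw [AddSubgroup.mem_elems] at hc hc'
    apply hfe
    have : f - e = c' - c := by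
      simp only [vadd_eq_add] at h
      rw [sub_eq_sub_iff_add_eq_add, ← h, add_comm]
    rw [this]
    exact sub_mem hc' hc
  have h1 : #((f +ᵥ N.elems) ∪ (e +ᵥ N.elems) ∪ B) ≤ #(N.elems + B) :=
    card_le_card (union_subset (union_subset (hsub hf) (hsub he))
      (subset_add_right B (by simp)))
  have h2 := card_union_add_card_inter ((f +ᵥ N.elems) ∪ (e +ᵥ N.elems)) B
  rw [card_union_of_disjoint hdisj, card_vadd_elems, card_vadd_elems] at h2
  have h3 : ((f +ᵥ N.elems) ∪ (e +ᵥ N.elems)) ∩ B ⊆ cosetPart N f B ∪ cosetPart N e B := by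
    intro z hz
    obtain ⟨hz, hzB⟩ := mem_inter.1 hz
    rcases mem_union.1 hz with hz | hz <;> obtain ⟨c, hc, rfl⟩ := mem_vadd_finset.1 hz
    · exact mem_union_left _ (mem_cosetPart.2 ⟨hzB, by simpa using hc⟩)
    · exact mem_union_right _ (mem_cosetPart.2 ⟨hzB, by simpa using hc⟩)
  have h4 := (card_le_card h3).trans (card_union_le _ _)
  omega

/-- Otherwise two coset parts F, E of M satisfy #F + #E > #N. Differences from F × E are distinct
and lie in one coset, so #F * #E ≤ #N. Hence one part is a single point and the other a full coset,
which has nonzero periods. -/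
theorem IsSidonLike.card_lt_card_elems_add {M : Finset G} (hM : IsSidonLike M) (h0 : 0 ∈ M)
    {N : AddSubgroup G} (hN : N ≠ ⊥) (hMN : ¬ M ⊆ N.elems) :
    #N.elems + #M ≤ #(N.elems + M) := by
  by_contra! hlt
  obtain ⟨f, hf, hfN⟩ := not_subset.1 hMN
  rw [AddSubgroup.mem_elems] at hfN
  have hcard := card_lt_card_cosetPart_add (N := N) (by omega) hf h0 (by simpa using hfN)
  set F := cosetPart N f M
  set E := cosetPart N 0 M
  have hFM : F ⊆ M := cosetPart_subset
  have hEM : E ⊆ M := cosetPart_subset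
  have hfF : f ∈ F := mem_cosetPart.2 ⟨hf, by simp⟩
  have h0E : (0 : G) ∈ E := mem_cosetPart.2 ⟨h0, by simp⟩
  have hprod : #F * #E ≤ #N.elems := by
    rw [← card_product, ← card_vadd_elems N f]
    refine card_le_card_of_injOn (fun p => p.1 - p.2) ?_ ?_
    · intro p hp
      obtain ⟨h1, h2⟩ := mem_product.1 (mem_coe.1 hp)
      have h1 := (mem_cosetPart.1 h1).2
      have h2 := (mem_cosetPart.1 h2).2
      refine mem_coe.2 (mem_vadd_finset.2 ⟨p.1 - f - (p.2 - 0), ?_, ?_⟩)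
      · exact AddSubgroup.mem_elems.2 (sub_mem h1 h2)
      · simp only [vadd_eq_add]; abel
    · rintro ⟨a, b⟩ hp ⟨a', b'⟩ hp' h
      obtain ⟨ha, hb⟩ := mem_product.1 (mem_coe.1 hp)
      obtain ⟨ha', hb'⟩ := mem_product.1 (mem_coe.1 hp')
      simp only at h ha hb ha' hb'
      by_cases hx : a - a' = 0
      · rw [sub_eq_zero] at hx
        subst hx
        simpa using h
      · exfalso
        have hne : a ≠ b := by
          rintro rfl
          have h1 := (mem_cosetPart.1 ha).2
          have h2 := (mem_cosetPart.1 hb).2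
          apply hfN
          simpa using sub_mem h2 h1
        refine absurd (hM _ hx) (not_le.2 (one_lt_card.2 ⟨a, ?_, b, ?_, hne⟩))
        · exact mem_inter.2 ⟨hFM ha, mem_vadd_finset.2 ⟨a', hFM ha', by simp⟩⟩
        · refine mem_inter.2 ⟨hEM hb, mem_vadd_finset.2 ⟨b', hEM hb', ?_⟩⟩
          rw [vadd_eq_add, sub_add_eq_add_sub, sub_eq_iff_eq_add]
          rw [sub_eq_sub_iff_add_eq_add] at h
          rw [h, add_comm]
  have hfull : ∀ y : G, ¬ (y +ᵥ N.elems ⊆ M) := by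
    intro y hy
    obtain ⟨x, hx, hx0⟩ := N.bot_or_exists_ne_zero.resolve_left hN
    have hs : y +ᵥ N.elems ⊆ M ∩ (x +ᵥ M) := by
      refine subset_inter hy fun z hz => ?_
      obtain ⟨c, hc, rfl⟩ := mem_vadd_finset.1 hz
      refine mem_vadd_finset.2 ⟨y + (c - x), hy (mem_vadd_finset.2 ⟨c - x, ?_, rfl⟩), ?_⟩
      · exact AddSubgroup.mem_elems.2 (sub_mem (by simpa using hc) hx)
      · simp only [vadd_eq_add]; abel
    have h1 := (card_le_card hs).trans (hM x hx0)
    rw [card_vadd_elems] at h1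
    have := AddSubgroup.one_lt_card_elems hN
    omega
  have hF1 : 0 < #F := card_pos.2 ⟨f, hfF⟩
  have hE1 : 0 < #E := card_pos.2 ⟨0, h0E⟩
  have hFN : #F < #N.elems := by
    by_contra! h
    have : F = f +ᵥ N.elems := eq_of_subset_of_card_le cosetPart_subset_vadd
      (by rwa [card_vadd_elems])
    exact hfull f (this ▸ hFM)
  have hEN : #E < #N.elems := by
    by_contra! h
    have : E = (0 : G) +ᵥ N.elems := eq_of_subset_of_card_le cosetPart_subset_vadd
      (by rwa [card_vadd_elems])
    exact hfull 0 (this ▸ hEM)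
  obtain ⟨a, ha⟩ : ∃ a, #F = a + 1 := ⟨#F - 1, by omega⟩
  obtain ⟨b, hb⟩ : ∃ b, #E = b + 1 := ⟨#E - 1, by omega⟩
  rw [ha, hb] at hprod
  have hab : a * b = 0 := by nlinarith
  rcases mul_eq_zero.1 hab with h | h <;> omega

/-- A generalization of Vosper's theorem: a generating set `S` which has a small sumset with some `X` almost fills its cosets of some subgroup, unless the
group is cyclic. -/
theorem exists_card_elems_add_lt_or_isAddCyclic {S X : Finset G} (h0 : 0 ∈ S)
    (hgen : AddSubgroup.closure (S : Set G) = ⊤) (hS2 : 2 ≤ #S)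
    (hX2 : 2 ≤ #X) (hXS : #(X + S) + 2 ≤ Fintype.card G)
    (hXS' : #(X + S) + 1 ≤ #X + #S) :
    (∃ H : AddSubgroup G, H ≠ ⊥ ∧ ¬ S ⊆ H.elems ∧ #(H.elems + S) + 1 ≤ #H.elems + #S) ∨
      IsAddCyclic G := by
  have htop : ∀ H : AddSubgroup G, S ⊆ H.elems → H = ⊤ := fun H hH => by
    rw [eq_top_iff, ← hgen, AddSubgroup.closure_le]
    exact fun x hx => AddSubgroup.mem_elems.1 (hH hx)
  have hcardtop : #(⊤ : AddSubgroup G).elems = Fintype.card G := by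
    rw [← card_univ]; congr; ext; simp
  have hatom : ∃ M, IsAtomOf 2 S M ∧ 0 ∈ M := by
    obtain ⟨M, hM⟩ := exists_isAtomOf (show SumSeparable 2 S X from ⟨hX2, hXS⟩)
    obtain ⟨m, hm⟩ : M.Nonempty := card_pos.1 (by have := hM.sep.1; omega)
    exact ⟨-m +ᵥ M, hM.vadd _, mem_vadd_finset.2 ⟨m, hm, by simp⟩⟩
  obtain ⟨M, hM, hM0⟩ := hatom
  have hM2 := hM.sep.1
  have hMS := hM.sep.2
  have hMS' := hM.le X ⟨hX2, hXS⟩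
  rcases hM.isSidonLike_or_exists_elems_eq hM0 with hsid | ⟨H, rfl⟩
  swap
  · refine Or.inl ⟨H, ?_, ?_, by omega⟩
    · rintro rfl
      have : (⊥ : AddSubgroup G).elems = {0} := by ext; simp
      rw [this] at hM2
      simp at hM2
    · intro h
      rw [htop H h] at hMS
      have := card_le_card_add_right (s := (⊤ : AddSubgroup G).elems) (t := S) ⟨0, h0⟩
      omega
  -- The roles of `S` and the atom `M` are exchanged: `S` nearly fills its cosets of the subgroup
  -- generated by `M`, which is the required subgroup unless it is all of G.
  have hW := card_add_elems_le_of_forall (S := S) rfl hM0 hM2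
    (fun N hN hMN => (hsid.card_lt_card_elems_add hM0 hN hMN).trans (Nat.le_succ _))
    (by rw [add_comm S M]; omega)
  set K := AddSubgroup.closure (M : Set G) with hK
  have hMK : M ⊆ K.elems := fun a ha =>
    AddSubgroup.mem_elems.2 (AddSubgroup.subset_closure ha)
  by_cases hKtop : K = ⊤
  swap
  · refine Or.inl ⟨K, ?_, fun h => hKtop (htop K h), ?_⟩
    · intro hbot
      rw [hbot] at hMK
      have := card_le_card hMK
      have h1 : (⊥ : AddSubgroup G).elems = {0} := by ext; simp
      rw [h1, card_singleton] at this
      omega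
    · rw [add_comm K.elems S]; omega
  right
  rcases hM2.eq_or_lt with h2 | h3
  · obtain ⟨a, b, hab, rfl⟩ := card_eq_two.1 h2.symm
    have : ∃ d, ∀ x ∈ ({a, b} : Finset G), x ∈ AddSubgroup.zmultiples d := by
      simp only [mem_insert, mem_singleton] at hM0
      rcases hM0 with rfl | rfl
      · exact ⟨b, by simp⟩
      · exact ⟨a, by simp⟩
    obtain ⟨d, hd⟩ := this
    refine ⟨d, fun x => ?_⟩
    have hle : K ≤ AddSubgroup.zmultiples d := (AddSubgroup.closure_le _).2 fun x hx => hd x hx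
    exact hle (hKtop ▸ AddSubgroup.mem_top x)
  · exfalso
    -- When #M ≥ 3, take a 2-atom N of `M` itself. If N is Sidon-like, two points of N force #N ≥
    -- #M, and then Bonferroni contradicts #(N + M) < #N + #M. If N is a subgroup, the bound for
    -- Sidon-like `M` is violated.
    have hsepS : SumSeparable 2 M S := ⟨hS2, by rwa [add_comm S M]⟩
    obtain ⟨N', hN'⟩ := exists_isAtomOf hsepS
    obtain ⟨n, hn⟩ : N'.Nonempty := card_pos.1 (by have := hN'.sep.1; omega)
    have hN := hN'.vadd (-n)
    have hN0 : (0 : G) ∈ -n +ᵥ N' := mem_vadd_finset.2 ⟨n, hn, by simp⟩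
    set N := -n +ᵥ N'
    have hN2 := hN.sep.1
    have hNM := hN.sep.2
    have hNM' := hN.le S hsepS
    rw [add_comm S M] at hNM'
    rcases hN.isSidonLike_or_exists_elems_eq hN0 with hsidN | ⟨H, hH⟩
    · obtain ⟨T, hT, hT2⟩ := exists_subset_card_eq hN2
      have h4 := hsid.card_add T
      have h5 : #(T + M) ≤ #(N + M) := card_le_card (add_subset_add_right hT)
      have h6 := hsidN.card_add M
      rw [hT2] at h4
      rw [add_comm M N] at h6
      obtain ⟨a, ha⟩ : ∃ a, #M = a + 3 := ⟨#M - 3, by omega⟩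
      have e : a + 3 - 1 = a + 2 := rfl
      rw [ha, e] at h6
      have : #(N + M) ≤ a + 3 + #N - 1 := by omega
      have h7 : a + 3 ≤ #N := by omega
      obtain ⟨c, hc⟩ : ∃ c, #N = a + 3 + c := ⟨#N - (a + 3), by omega⟩
      have h8 : #(N + M) ≤ 2 * a + 5 + c := by omega
      rw [hc] at h6
      linarith [Nat.zero_le (a * c), Nat.zero_le (a * a)]
    · rw [← hH] at hNM hNM' hN2
      have hbot : H ≠ ⊥ := by
        rintro rfl
        have : (⊥ : AddSubgroup G).elems = {0} := by ext; simp
        rw [this] at hN2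
        simp at hN2
      have := hsid.card_lt_card_elems_add hM0 hbot (by
        intro h
        have hle : K ≤ H := (AddSubgroup.closure_le _).2 fun x hx => AddSubgroup.mem_elems.1 (h hx)
        rw [hKtop, top_le_iff] at hle
        rw [hle] at hNM
        have := card_le_card_add_right (s := (⊤ : AddSubgroup G).elems) (t := M) ⟨0, hM0⟩
        omega)
      omega

end Isoperimetric

/-! ### Iterated sumsets, and exchanging summands within cosets. -/

section SumFree

theorem mem_hFoldSumset_succ {G : Type*} [AddCommGroup G] {h : ℕ} {A : Set G} {x : G} :
    x ∈ hFoldSumset (h + 1) A ↔ ∃ y ∈ hFoldSumset h A, ∃ a ∈ A, y + a = x := by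
  constructor
  · rintro ⟨f, hf, rfl⟩
    exact ⟨∑ i, f (Fin.succ i), ⟨_, fun i => hf _, rfl⟩, f 0, hf 0, by
      rw [Fin.sum_univ_succ, add_comm]⟩
  · rintro ⟨_, ⟨f, hf, rfl⟩, a, ha, rfl⟩
    refine ⟨Fin.cons a f, fun i => ?_, by rw [Fin.sum_univ_succ]; simp [add_comm]⟩
    induction i using Fin.cases with
    | zero => simpa using ha
    | succ i => simpa using hf i

theorem mem_hFoldSumset_zero {G : Type*} [AddCommGroup G] {A : Set G} {x : G} :
    x ∈ hFoldSumset 0 A ↔ x = 0 := by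
  constructor
  · rintro ⟨f, -, rfl⟩
    simp
  · rintro rfl
    exact ⟨0, fun i => i.elim0, by simp⟩

theorem map_mem_hFoldSumset {G Q : Type*} [AddCommGroup G] [AddCommGroup Q] (φ : G →+ Q)
    {h : ℕ} {A : Set G} {x : G} (hx : x ∈ hFoldSumset h A) : φ x ∈ hFoldSumset h (φ '' A) := by
  obtain ⟨f, hf, rfl⟩ := hx
  exact ⟨φ ∘ f, fun i => ⟨_, hf i, rfl⟩, by simp⟩

theorem hFoldSumset_image {G Q : Type*} [AddCommGroup G] [AddCommGroup Q] (φ : G →+ Q)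
    {h : ℕ} {A : Set G} : hFoldSumset h (φ '' A) = φ '' hFoldSumset h A := by
  refine Set.Subset.antisymm ?_ ?_
  · rintro _ ⟨f, hf, rfl⟩
    choose g hg hfg using hf
    exact ⟨∑ i, g i, ⟨g, hg, rfl⟩, by simp [hfg]⟩
  · rintro _ ⟨x, hx, rfl⟩
    exact map_mem_hFoldSumset φ hx

theorem nsmul_mem_hFoldSumset {G : Type*} [AddCommGroup G] {h : ℕ} {A : Set G} {a : G}
    (ha : a ∈ A) : h • a ∈ hFoldSumset h A :=
  ⟨fun _ => a, fun _ => ha, by simp⟩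

theorem isSumFreeKL_symm {G : Type*} [AddCommGroup G] {k l : ℕ} {A : Set G} :
    IsSumFreeKL k l A ↔ IsSumFreeKL l k A := by
  rw [IsSumFreeKL, IsSumFreeKL, Set.inter_comm]

/-- The sums of `i` elements of `B` minus the sums of `j` elements of `B`. -/
noncomputable def sumDiff {G : Type*} [AddCommGroup G] [DecidableEq G] (B : Finset G) :
    ℕ → ℕ → Finset G
  | 0, 0 => {0}
  | i + 1, 0 => sumDiff B i 0 + B
  | i, j + 1 => sumDiff B i j + -B

section

variable {G : Type*} [AddCommGroup G] [DecidableEq G]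

theorem sumDiff_succ_zero (B : Finset G) (i : ℕ) :
    sumDiff B (i + 1) 0 = sumDiff B i 0 + B := by
  rw [sumDiff]

theorem sumDiff_succ (B : Finset G) (i j : ℕ) :
    sumDiff B i (j + 1) = sumDiff B i j + -B := by
  rw [sumDiff]

theorem mem_sumDiff {B : Finset G} {i j : ℕ} {z : G} :
    z ∈ sumDiff B i j ↔ ∃ x ∈ hFoldSumset i (B : Set G), ∃ y ∈ hFoldSumset j (B : Set G),
      x - y = z := by
  induction j generalizing z with
  | zero =>
    simp only [mem_hFoldSumset_zero, exists_eq_left, sub_zero, exists_eq_right]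
    induction i generalizing z with
    | zero => simp [sumDiff, mem_hFoldSumset_zero]
    | succ i ih =>
      rw [sumDiff_succ_zero, mem_add, mem_hFoldSumset_succ]
      simp only [ih, mem_coe]
  | succ j ih =>
    rw [sumDiff_succ, mem_add]
    simp only [ih, mem_hFoldSumset_succ]
    constructor
    · rintro ⟨_, ⟨x, hx, y, hy, rfl⟩, c, hc, rfl⟩
      exact ⟨x, hx, y + -c, ⟨y, hy, -c, mem_neg'.1 hc, rfl⟩, by abel⟩
    · rintro ⟨x, hx, _, ⟨y, hy, a, ha, rfl⟩, rfl⟩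
      exact ⟨x - y, ⟨x, hx, y, hy, rfl⟩, -a, by simpa using ha, by abel⟩

theorem isSumFreeKL_iff_zero_notMem_sumDiff {B : Finset G} {k l : ℕ} :
    IsSumFreeKL k l (B : Set G) ↔ (0 : G) ∉ sumDiff B k l := by
  rw [IsSumFreeKL, Set.eq_empty_iff_forall_notMem, mem_sumDiff]
  simp only [sub_eq_zero, Set.mem_inter_iff]
  constructor
  · rintro h ⟨x, hx, _, hy, rfl⟩
    exact h x ⟨hx, hy⟩
  · rintro h x ⟨hx, hy⟩
    exact h ⟨x, hx, x, hy, rfl⟩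

/-- A property of sets with a weight, stable under adding `B` or `-B`, passes to `sumDiff`. -/
theorem sumDiff_induction {B : Finset G} {P : ℕ → Finset G → Prop} (h1 : P 1 B)
    (hadd : ∀ c X, 1 ≤ c → P c X → P (c + 1) (X + B))
    (hsub : ∀ c X, 1 ≤ c → P c X → P (c + 1) (X + -B)) {i j : ℕ} (hi : 1 ≤ i) :
    P (i + j) (sumDiff B i j) := by
  induction j with
  | zero =>
    induction i, hi using Nat.le_induction with
    | base =>
      rw [sumDiff_succ_zero, sumDiff, singleton_zero, zero_add]
      exact h1
    | succ i hi ih =>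
      rw [sumDiff_succ_zero]
      exact hadd _ _ (by omega) ih
  | succ j ih =>
    rw [sumDiff_succ, ← add_assoc]
    exact hsub _ _ (by omega) ih

end

section Finite

variable {G : Type*} [AddCommGroup G] [Fintype G] [DecidableEq G]

/-- Pigeonhole: the part of B at f and the part at e shifted by -t share a coset of N and have more
than #N elements together. -/
theorem exists_eq_add_of_card_lt {B : Finset G} {N : AddSubgroup G}
    (hN : #(N.elems + B) + 1 ≤ #N.elems + #B) {f e t : G} (hf : f ∈ B) (he : e ∈ B)
    (hfe : f - e ∉ N) (ht : f - e + t ∈ N) : ∃ f' ∈ B, ∃ e' ∈ B, f' - e' + t = 0 := by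
  have hcard := card_lt_card_cosetPart_add hN hf he hfe
  have hsub : cosetPart N f B ∪ (-t +ᵥ cosetPart N e B) ⊆ f +ᵥ N.elems := by
    refine union_subset cosetPart_subset_vadd fun z hz => ?_
    obtain ⟨y, hy, rfl⟩ := mem_vadd_finset.1 hz
    refine mem_vadd_finset.2 ⟨y - e - (f - e + t), ?_, by simp only [vadd_eq_add]; abel⟩
    exact AddSubgroup.mem_elems.2 (sub_mem (mem_cosetPart.1 hy).2 ht)
  have h1 := card_le_card hsub
  have h2 := card_union_add_card_inter (cosetPart N f B) (-t +ᵥ cosetPart N e B)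
  rw [card_vadd_elems] at h1
  rw [card_vadd_finset] at h2
  obtain ⟨z, hz⟩ := card_pos.1 (show 0 < #(cosetPart N f B ∩ (-t +ᵥ cosetPart N e B)) by omega)
  obtain ⟨hz1, hz2⟩ := mem_inter.1 hz
  obtain ⟨y, hy, rfl⟩ := mem_vadd_finset.1 hz2
  exact ⟨_, cosetPart_subset hz1, y, cosetPart_subset hy, by simp only [vadd_eq_add]; abel⟩

/-- A positive and a negative summand of z in different cosets of N can be re-chosen within those
cosets so that the total becomes 0. If no such pair is available among f, f', g, replacing f' and g
by one b from another coset keeps the total in N and creates one; this is why two positive summands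
are needed. -/
theorem zero_mem_sumDiff_of_card_lt {B : Finset G} {N : AddSubgroup G} {k l : ℕ}
    (hN : #(N.elems + B) + 1 ≤ #N.elems + #B) (hB : ∀ b ∈ B, ∃ c ∈ B, c - b ∉ N)
    {z : G} (hz : z ∈ sumDiff B (k + 2) (l + 1)) (hzN : z ∈ N) :
    (0 : G) ∈ sumDiff B (k + 2) (l + 1) := by
  simp only [mem_sumDiff, mem_hFoldSumset_succ, mem_coe] at hz
  obtain ⟨_, ⟨_, ⟨x, hx, f, hf, rfl⟩, f', hf', rfl⟩, _, ⟨y, hy, g, hg, rfl⟩, rfl⟩ := hz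
  have key : ∀ x' ∈ hFoldSumset (k + 1) (B : Set G), ∀ f ∈ B, ∀ g ∈ B,
      x' + f - (y + g) ∈ N → f - g ∉ N → (0 : G) ∈ sumDiff B (k + 2) (l + 1) := by
    intro x' hx' f hf g hg h hfg
    obtain ⟨a, ha, b, hb, hab⟩ := exists_eq_add_of_card_lt (t := x' - y) hN hf hg hfg
      (by convert h using 1; abel)
    rw [mem_sumDiff]
    refine ⟨x' + a, mem_hFoldSumset_succ.2 ⟨x', hx', a, ha, rfl⟩, y + b,
      mem_hFoldSumset_succ.2 ⟨y, hy, b, hb, rfl⟩, ?_⟩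
    rw [← hab]; abel
  by_cases h1 : f' - g ∈ N
  swap
  · exact key (x + f) (mem_hFoldSumset_succ.2 ⟨x, hx, f, hf, rfl⟩) f' hf' g hg hzN h1
  by_cases h2 : f - g ∈ N
  swap
  · refine key (x + f') (mem_hFoldSumset_succ.2 ⟨x, hx, f', hf', rfl⟩) f hf g hg ?_ h2
    convert hzN using 1; abel
  obtain ⟨b, hb, hbg⟩ := hB f' hf'
  refine key (x + b) (mem_hFoldSumset_succ.2 ⟨x, hx, b, hb, rfl⟩) f hf b hb ?_ ?_
  · have := sub_mem hzN h1
    convert this using 1; abel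
  · intro h
    apply hbg
    have := sub_mem (sub_mem h2 h) h1
    convert this using 1; abel

end Finite
end SumFree

/-! ### Reduction to a cyclic quotient. -/

section Core

theorem isAddCyclic_of_forall_exists_mem_sumDiff {G : Type*} [AddCommGroup G] [Fintype G]
    [DecidableEq G] {B : Finset G} {k l : ℕ} (h0 : (0 : G) ∉ sumDiff B (k + 2) (l + 1))
    (hmeet : ∀ H : AddSubgroup G, H ≠ ⊥ → ∃ z ∈ sumDiff B (k + 2) (l + 1), z ∈ H)
    (hB : 2 ≤ #B) (hcard : Fintype.card G < (k + l + 3) * #B) : IsAddCyclic G := by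
  obtain ⟨b₀, hb₀⟩ : B.Nonempty := card_pos.1 (by omega)
  set A : Finset G := {-b₀} + B with hA
  have hBA : B = {b₀} + A := by
    rw [hA, ← add_assoc, singleton_add_singleton, add_neg_cancel, singleton_zero, zero_add]
  have hAc : #A = #B := card_singleton_add _ _
  have hA0 : (0 : G) ∈ A := mem_add.2 ⟨_, mem_singleton_self _, b₀, hb₀, by simp⟩
  have hXA : ∀ X : Finset G, #(X + A) = #(X + B) := fun X => by
    rw [hA, add_left_comm, card_singleton_add]
  have hgood : ∀ N : AddSubgroup G, N ≠ ⊥ → ¬ A ⊆ N.elems → #N.elems + #A ≤ #(N.elems + A) := by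
    intro N hN hAN
    by_contra! hlt
    obtain ⟨z, hz, hzN⟩ := hmeet N hN
    refine h0 (zero_mem_sumDiff_of_card_lt (N := N) (by rw [← hXA]; omega) ?_ hz hzN)
    intro b hb
    by_contra! hall
    apply hAN
    intro a ha
    obtain ⟨_, h1, c, hc, rfl⟩ := mem_add.1 ha
    rw [mem_singleton.1 h1, AddSubgroup.mem_elems]
    convert sub_mem (hall c hc) (hall b₀ hb₀) using 1
    abel
  set L := AddSubgroup.closure (A : Set G) with hL
  have hAL : A ⊆ L.elems := fun a ha => by
    rw [AddSubgroup.mem_elems]; exact AddSubgroup.subset_closure ha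
  have hLL : L.elems + L.elems = L.elems := by
    refine Subset.antisymm (fun z hz => ?_) (subset_add_left _ (by simp))
    obtain ⟨x, hx, y, hy, rfl⟩ := mem_add.1 hz
    rw [AddSubgroup.mem_elems] at *
    exact add_mem hx hy
  have hLneg : -L.elems = L.elems := by
    ext; simp
  have hgrow : ∀ X : Finset G, X + B + L.elems ≠ X + B → #X + #B ≤ #(X + B) + 1 := by
    intro X hX
    rw [← hXA, ← hAc]
    refine card_add_card_le_of_forall rfl hA0
      (fun N h1 h2 => (hgood N h1 h2).trans (Nat.le_succ _)) fun h => hX ?_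
    rw [hBA, add_left_comm, h, add_assoc, add_assoc, hLL]
  have hflip : ∀ X : Finset G, -(-X + B) = X + -B := fun X => by
    rw [neg_add, neg_neg]
  have hper : ∀ X : Finset G, -X + L.elems = -X ↔ X + L.elems = X := fun X => by
    rw [← neg_inj, neg_add, neg_neg, hLneg]
  have hgrow' : ∀ X : Finset G, X + -B + L.elems ≠ X + -B → #X + #B ≤ #(X + -B) + 1 := by
    intro X hX
    rw [← hflip, Ne, hper] at hX
    have := hgrow (-X) hX
    rwa [card_neg, ← card_neg (-X + B), hflip] at this
  have hL1 : L ≠ ⊥ := by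
    intro h
    rw [h] at hAL
    have := card_le_card hAL
    have h1 : (⊥ : AddSubgroup G).elems = {0} := by ext; simp
    rw [h1, card_singleton] at this
    omega
  obtain ⟨z, hz, hzL⟩ := hmeet L hL1
  set T := sumDiff B (k + 2) (l + 1) with hT
  -- T meets L but omits 0, so T is not a union of cosets of L; the Mann bound therefore applies up
  -- to the last summand.
  have hTL : T + L.elems ≠ T := fun h => h0 (h ▸ mem_add.2 ⟨z, hz, -z, by simpa using hzL, by simp⟩)
  by_cases hLtop : L = ⊤
  · by_contra hcyc
    -- For noncyclic G the Vosper bound gains one over Mann's, so c summands give at least c * #B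
    -- elements or all but one of G. The last summand uses only Mann's bound, which already forces T
    -- to be everything.
    have hgrow2 : ∀ X : Finset G, 2 ≤ #X → #(X + B) + 2 ≤ Fintype.card G →
        #X + #B ≤ #(X + B) := by
      intro X hX2 hX
      by_contra! hlt
      rw [← hXA] at hX hlt
      rcases exists_card_elems_add_lt_or_isAddCyclic hA0 hLtop (by omega) hX2 hX (by omega) with
        ⟨N, h1, h2, h3⟩ | h
      · have := hgood N h1 h2
        omega
      · exact hcyc h
    have hstep : ∀ c (X : Finset G), 1 ≤ c →
        (2 ≤ #X ∧ (c * #B ≤ #X ∨ Fintype.card G ≤ #X + 1)) →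
        (2 ≤ #(X + B) ∧ ((c + 1) * #B ≤ #(X + B) ∨ Fintype.card G ≤ #(X + B) + 1)) := by
      rintro c X - ⟨hX2, hX⟩
      have hle : #X ≤ #(X + B) := card_le_card_add_right ⟨b₀, hb₀⟩
      refine ⟨hX2.trans hle, ?_⟩
      by_cases h : #(X + B) + 2 ≤ Fintype.card G
      · have := hgrow2 X hX2 h
        left
        rw [add_mul, one_mul]
        omega
      · omega
    have hU := sumDiff_induction (B := B)
      (P := fun c X => 2 ≤ #X ∧ (c * #B ≤ #X ∨ Fintype.card G ≤ #X + 1)) (by simpa using hB)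
      hstep (fun c X hc hX => by
        have := hstep c (-X) hc (by simpa only [card_neg] using hX)
        rwa [← card_neg (-X + B), hflip] at this) (show 1 ≤ k + 2 by omega) (j := l)
    rw [sumDiff_succ] at hT
    have h1 := hgrow' (sumDiff B (k + 2) l) (by rwa [← hT])
    rw [← hT] at h1
    have h2 : #T < Fintype.card G := card_lt_univ_of_notMem h0
    obtain ⟨-, h3 | h3⟩ := hU
    · have : (k + l + 3) * #B = (k + 2 + l) * #B + #B := by ring
      omega
    · omega
  · exfalso
    have hdiff := sumDiff_induction (B := B) (P := fun _ X => ∀ x ∈ X, ∀ y ∈ X, x - y ∈ L)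
      (by
        intro x hx y hy
        have h1 : ∀ c ∈ B, -b₀ + c ∈ L := fun c hc =>
          AddSubgroup.mem_elems.1 (hAL (mem_add.2 ⟨_, mem_singleton_self _, c, hc, rfl⟩))
        convert sub_mem (h1 x hx) (h1 y hy) using 1
        abel)
      (by
        intro c X _ hX x hx y hy
        have h1 : ∀ c ∈ B, -b₀ + c ∈ L := fun c hc =>
          AddSubgroup.mem_elems.1 (hAL (mem_add.2 ⟨_, mem_singleton_self _, c, hc, rfl⟩))
        obtain ⟨u, hu, b, hb, rfl⟩ := mem_add.1 hx
        obtain ⟨v, hv, b', hb', rfl⟩ := mem_add.1 hy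
        convert add_mem (hX u hu v hv) (sub_mem (h1 b hb) (h1 b' hb')) using 1
        abel)
      (by
        intro c X _ hX x hx y hy
        have h1 : ∀ c ∈ B, -b₀ + c ∈ L := fun c hc =>
          AddSubgroup.mem_elems.1 (hAL (mem_add.2 ⟨_, mem_singleton_self _, c, hc, rfl⟩))
        obtain ⟨u, hu, b, hb, rfl⟩ := mem_add.1 hx
        obtain ⟨v, hv, b', hb', rfl⟩ := mem_add.1 hy
        convert sub_mem (hX u hu v hv) (sub_mem (h1 _ (mem_neg'.1 hb)) (h1 _ (mem_neg'.1 hb')))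
          using 1
        abel) (show 1 ≤ k + 2 by omega) (j := l + 1)
    -- T lies in a single coset of L and meets L, so it is contained in L, of order at most half
    -- that of G. The factor 2 absorbs the loss from using only Mann's bound.
    have hTsub : insert 0 T ⊆ L.elems := by
      refine insert_subset (by simp) fun t ht => ?_
      rw [AddSubgroup.mem_elems]
      simpa using add_mem (hdiff t ht z hz) hzL
    have hTc := card_le_card hTsub
    rw [card_insert_of_notMem h0] at hTc
    have h2L := AddSubgroup.two_mul_card_elems_le hLtop
    obtain ⟨m, hm⟩ : ∃ m, #B = m + 2 := ⟨#B - 2, by omega⟩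
    have hstep : ∀ c (X : Finset G), 1 ≤ c →
        (X + L.elems = X ∨ c * (m + 1) + 1 ≤ #X) →
        (X + B + L.elems = X + B ∨ (c + 1) * (m + 1) + 1 ≤ #(X + B)) := by
      intro c X _ hX
      by_cases h : X + B + L.elems = X + B
      · exact Or.inl h
      · have h1 := hgrow X h
        rcases hX with hX | hX
        · exact absurd (by rw [add_right_comm, hX]) h
        · right
          rw [add_mul, one_mul]
          omega
    have hP := sumDiff_induction (B := B)
      (P := fun c X => X + L.elems = X ∨ c * (m + 1) + 1 ≤ #X) (Or.inr (by omega))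
      hstep (fun c X hc hX => by
        have := hstep c (-X) hc (by simpa only [card_neg, hper] using hX)
        rwa [← card_neg (-X + B), ← hper, hflip] at this) (show 1 ≤ k + 2 by omega)
        (j := l + 1)
    have h3 := hP.resolve_left hTL
    rw [← hT] at h3
    rw [hm] at hcard
    nlinarith

theorem card_fiber_mul_card {G Q : Type*} [AddCommGroup G] [Fintype G] [AddCommGroup Q]
    [Fintype Q] [DecidableEq Q] (φ : G →+ Q) (hφ : Function.Surjective φ) (q : Q) :
    #{g | φ g = q} * Fintype.card Q = Fintype.card G := by
  have h := card_eq_sum_card_fiberwise (f := φ) (s := univ) (t := univ) (fun _ _ => by simp)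
  rw [card_univ, sum_congr rfl fun q' _ => AddMonoidHom.card_fiber_eq_of_mem_range φ
    (hφ q') (hφ q), sum_const, card_univ, smul_eq_mul] at h
  rw [h, mul_comm]

theorem card_mul_card_le_card_image_mul {G Q : Type*} [AddCommGroup G] [Fintype G]
    [AddCommGroup Q] [Fintype Q] [DecidableEq Q] (φ : G →+ Q) (hφ : Function.Surjective φ)
    (B : Finset G) : #B * Fintype.card Q ≤ #(B.image φ) * Fintype.card G := by
  have h := card_le_mul_card_image (f := φ) B #{g | φ g = 0} fun q _ => by
    refine (card_le_card (filter_subset_filter _ (subset_univ _))).trans (le_of_eq ?_)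
    exact AddMonoidHom.card_fiber_eq_of_mem_range φ (hφ q) (hφ 0)
  have h2 := card_fiber_mul_card φ hφ 0
  rw [← h2]
  nlinarith [Nat.mul_le_mul_right (Fintype.card Q) h]

/-- This settles one-point sets {b}, where only (k - l)b must stay nonzero. -/
theorem exists_zmod_apply_ne_zero {G : Type*} [AddCommGroup G] [Finite G] {c : G} (hc : c ≠ 0) :
    ∃ (d : ℕ) (φ : G →+ ZMod d), Function.Surjective φ ∧ φ c ≠ 0 := by
  obtain ⟨ι, _, n, -, ⟨e⟩⟩ := AddCommGroup.equiv_directSum_zmod_of_finite' G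
  classical
  have h1 : e c ≠ 0 := by simpa using hc
  obtain ⟨i, hi⟩ : ∃ i, e c i ≠ 0 := by
    by_contra! h
    exact h1 (DFinsupp.ext h)
  refine ⟨n i, (DFinsupp.evalAddMonoidHom i).comp e.toAddMonoidHom, fun x => ?_, hi⟩
  refine ⟨e.symm (DirectSum.of (fun i => ZMod (n i)) i x), ?_⟩
  simp [DFinsupp.evalAddMonoidHom]

theorem exists_zmod_isSumFreeKL_image_aux (k l n : ℕ) {G : Type*} [AddCommGroup G] [Finite G]
    (hn : Nat.card G = n) (B : Finset G) (hB : IsSumFreeKL (k + 2) (l + 1) (B : Set G))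
    (hcard : Nat.card G < (k + l + 3) * #B) :
    ∃ (d : ℕ) (φ : G →+ ZMod d), Function.Surjective φ ∧
      IsSumFreeKL (k + 2) (l + 1) (φ '' B) := by
  classical
  induction n using Nat.strong_induction_on generalizing G with
  | _ n ih =>
  cases nonempty_fintype G
  rw [Nat.card_eq_fintype_card] at hn hcard
  by_cases hmeet : ∀ H : AddSubgroup G, H ≠ ⊥ → ∃ z ∈ sumDiff B (k + 2) (l + 1), z ∈ H
  · have hpos : 0 < #B := by
      by_contra! h
      simp [Nat.le_zero.1 h] at hcard
    rcases (show #B = 1 ∨ 2 ≤ #B by omega) with h1 | h2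
    · obtain ⟨b, rfl⟩ := card_eq_one.1 h1
      have hb : (k + 2) • b - (l + 1) • b ≠ 0 := by
        intro h
        rw [sub_eq_zero] at h
        have hmem : (k + 2) • b ∈ hFoldSumset (k + 2) (({b} : Finset G) : Set G) ∩
            hFoldSumset (l + 1) (({b} : Finset G) : Set G) := by
          refine ⟨nsmul_mem_hFoldSumset (by simp), ?_⟩
          rw [h]
          exact nsmul_mem_hFoldSumset (by simp)
        rw [IsSumFreeKL] at hB
        rw [hB] at hmem
        exact hmem
      obtain ⟨d, φ, hφ, hne⟩ := exists_zmod_apply_ne_zero hb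
      refine ⟨d, φ, hφ, ?_⟩
      rw [IsSumFreeKL, Set.eq_empty_iff_forall_notMem]
      rintro x ⟨⟨f, hf, rfl⟩, g, hg, hgf⟩
      simp only [coe_singleton, Set.image_singleton, Set.mem_singleton_iff] at hf hg
      apply hne
      simp only [hf, hg, sum_const, card_univ, Fintype.card_fin] at hgf
      rw [map_sub, map_nsmul, map_nsmul, hgf, sub_self]
    · have hcyc := isAddCyclic_of_forall_exists_mem_sumDiff
        (isSumFreeKL_iff_zero_notMem_sumDiff.1 hB) hmeet h2 hcard
      let e := (zmodAddCyclicAddEquiv hcyc).symm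
      refine ⟨_, e.toAddMonoidHom, e.surjective, ?_⟩
      have he : Function.Injective e.toAddMonoidHom := e.injective
      rw [IsSumFreeKL, hFoldSumset_image, hFoldSumset_image, ← Set.image_inter he]
      rw [IsSumFreeKL] at hB
      rw [hB, Set.image_empty]
  · push Not at hmeet
    obtain ⟨H, hH, hz⟩ := hmeet
    have hsurj := QuotientAddGroup.mk'_surjective H
    have hQ := H.card_eq_card_quotient_mul_card_addSubgroup
    have hH1 : 1 < Nat.card H := by
      rw [AddSubgroup.one_lt_card_iff_ne_bot]; exact hH
    have : Fintype (G ⧸ H) := Fintype.ofFinite _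
    have hQpos : 0 < Fintype.card (G ⧸ H) := Fintype.card_pos
    rw [Nat.card_eq_fintype_card, Nat.card_eq_fintype_card] at hQ
    have hc := card_mul_card_le_card_image_mul (QuotientAddGroup.mk' H) hsurj B
    have hGpos : 0 < Fintype.card G := Fintype.card_pos
    obtain ⟨d, φ, hφ, hfree⟩ := ih (Nat.card (G ⧸ H))
      (by rw [Nat.card_eq_fintype_card]; nlinarith) rfl (B.image (QuotientAddGroup.mk' H))
      (by
        rw [isSumFreeKL_iff_zero_notMem_sumDiff, mem_sumDiff, coe_image]
        simp only [hFoldSumset_image]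
        rintro ⟨_, ⟨x, hx, rfl⟩, _, ⟨y, hy, rfl⟩, h⟩
        rw [← map_sub, QuotientAddGroup.mk'_apply, QuotientAddGroup.eq_zero_iff] at h
        exact hz _ (mem_sumDiff.2 ⟨x, hx, y, hy, rfl⟩) h)
      (by
        rw [Nat.card_eq_fintype_card]
        by_contra! h
        have h1 := Nat.mul_le_mul_right (Fintype.card G) h
        have h2 := Nat.mul_le_mul_left (k + l + 3) hc
        have h3 := Nat.mul_lt_mul_of_pos_right hcard hQpos
        nlinarith)
    refine ⟨d, φ.comp (QuotientAddGroup.mk' H), hφ.comp hsurj, ?_⟩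
    rwa [coe_image, ← Set.image_comp, ← AddMonoidHom.coe_comp] at hfree

end Core

/-! ### Density comparison, intervals and the cyclic quotient of order v. -/

section Main

theorem exists_zmod_isSumFreeKL_image {k l : ℕ} (hk : 0 < k) (hl : 0 < l) (hkl : k ≠ l)
    {G : Type*} [AddCommGroup G] [Finite G] (B : Finset G)
    (hB : IsSumFreeKL k l (B : Set G)) (hcard : Nat.card G < (k + l) * #B) :
    ∃ (d : ℕ) (φ : G →+ ZMod d), Function.Surjective φ ∧ IsSumFreeKL k l (φ '' B) := by
  wlog h : l < k generalizing k l
  · obtain ⟨d, φ, h1, h2⟩ := this hl hk hkl.symm (isSumFreeKL_symm.1 hB)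
      (by rwa [add_comm]) (by omega)
    exact ⟨d, φ, h1, isSumFreeKL_symm.1 h2⟩
  -- Since k > l ≥ 1, the larger index has the two summands needed for the exchange argument.
  obtain ⟨k, rfl⟩ : ∃ k', k = k' + 2 := ⟨k - 2, by omega⟩
  obtain ⟨l, rfl⟩ : ∃ l', l = l' + 1 := ⟨l - 1, by omega⟩
  refine exists_zmod_isSumFreeKL_image_aux k l _ rfl B hB (hcard.trans_eq ?_)
  ring

theorem bddAbove_card_isSumFreeKL (k l : ℕ) (G : Type*) [AddCommGroup G] [Finite G] :
    BddAbove {m : ℕ | ∃ A : Finset G, IsSumFreeKL k l (A : Set G) ∧ A.card = m} := by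
  cases nonempty_fintype G
  refine ⟨Fintype.card G, ?_⟩
  rintro _ ⟨A, -, rfl⟩
  exact card_le_univ A

theorem card_le_maxSumFreeKL {k l : ℕ} {G : Type*} [AddCommGroup G] [Finite G] {A : Finset G}
    (hA : IsSumFreeKL k l (A : Set G)) : #A ≤ maxSumFreeKL k l G :=
  le_csSup (bddAbove_card_isSumFreeKL k l G) ⟨A, hA, rfl⟩

theorem exists_card_eq_maxSumFreeKL {k : ℕ} (hk : 0 < k) (l : ℕ) (G : Type*) [AddCommGroup G]
    [Finite G] : ∃ A : Finset G, IsSumFreeKL k l (A : Set G) ∧ #A = maxSumFreeKL k l G := by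
  refine Nat.sSup_mem ?_ (bddAbove_card_isSumFreeKL k l G)
  refine ⟨0, ∅, ?_, rfl⟩
  rw [IsSumFreeKL, Set.eq_empty_iff_forall_notMem]
  rintro x ⟨⟨f, hf, -⟩, -⟩
  simpa using hf ⟨0, hk⟩

theorem maxSumFreeKL_mul_card_le {k l : ℕ} (hk : 0 < k) {G Q : Type*} [AddCommGroup G]
    [Finite G] [AddCommGroup Q] [Finite Q] (φ : G →+ Q) (hφ : Function.Surjective φ) :
    maxSumFreeKL k l Q * Nat.card G ≤ maxSumFreeKL k l G * Nat.card Q := by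
  classical
  cases nonempty_fintype G
  cases nonempty_fintype Q
  obtain ⟨C, hC, hCc⟩ := exists_card_eq_maxSumFreeKL hk l Q
  have hfree : IsSumFreeKL k l ((univ.filter fun g => φ g ∈ C : Finset G) : Set G) := by
    rw [IsSumFreeKL, Set.eq_empty_iff_forall_notMem] at hC ⊢
    rintro x ⟨⟨f, hf, hfx⟩, g, hg, hgx⟩
    refine hC (φ x) ⟨⟨φ ∘ f, fun i => ?_, by simp [← hfx]⟩, φ ∘ g, fun i => ?_, by simp [← hgx]⟩
    · simpa using hf i
    · simpa using hg i
  have h1 := card_le_maxSumFreeKL hfree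
  have h2 : #(univ.filter fun g => φ g ∈ C) * Fintype.card Q = #C * Fintype.card G := by
    rw [card_eq_sum_card_fiberwise (f := φ) (s := univ.filter fun g => φ g ∈ C) (t := C)
      (fun x hx => by simpa using hx), sum_mul, ← smul_eq_mul, ← sum_const]
    refine sum_congr rfl fun q hq => ?_
    rw [← card_fiber_mul_card φ hφ q]
    congr 2
    ext g
    simp only [mem_filter, mem_univ, true_and, and_iff_right_iff_imp]
    rintro rfl
    exact hq
  rw [Nat.card_eq_fintype_card, Nat.card_eq_fintype_card, ← hCc, ← h2]
  exact Nat.mul_le_mul_right _ h1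

theorem hFoldSumset_zmod_interval {d h m : ℕ} {x : ZMod d} {c : ℤ}
    (hx : x ∈ hFoldSumset h ((range (m + 1)).image fun i : ℕ => ((c + i : ℤ) : ZMod d))) :
    ∃ t : ℕ, t ≤ h * m ∧ x = ((h * c + t : ℤ) : ZMod d) := by
  obtain ⟨f, hf, rfl⟩ := hx
  simp only [coe_image, Set.mem_image, mem_coe, mem_range] at hf
  choose i hi hif using hf
  refine ⟨∑ j, i j, ?_, ?_⟩
  · refine (sum_le_card_nsmul univ i m fun j _ => by have := hi j; omega).trans ?_
    simp
  · simp [← hif, sum_add_distrib]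

/-- Intervals provide large sum-free sets in cyclic groups. -/
theorem le_mul_maxSumFreeKL_zmod {k l d : ℕ} [NeZero d] (hk : 0 < k) (hl : 0 < l)
    (hd : ∀ j : ℕ, 1 ≤ j → j ≤ deltaKL k l d → ¬ d ≡ j [MOD (k + l)]) :
    d ≤ (k + l) * maxSumFreeKL k l (ZMod d) := by
  have hdpos : 0 < d := NeZero.pos d
  -- Dividing d - 1 rather than d makes s + 1 the residue of d in 1, ..., k + l, so the hypothesis
  -- gives δ ≤ s; an interval of q + 1 points has density at least 1/(k+l).
  set q := (d - 1) / (k + l) with hq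
  set s := (d - 1) % (k + l) with hs
  have hqs : d = (k + l) * q + s + 1 := by
    have := Nat.div_add_mod (d - 1) (k + l)
    rw [← hq, ← hs] at this
    omega
  have hslt : s < k + l := Nat.mod_lt _ (by omega)
  set δ := deltaKL k l d with hδ
  have hδpos : 0 < δ := Int.gcd_pos_of_ne_zero_left _ (by exact_mod_cast hdpos.ne')
  have hsδ : δ ≤ s := by
    by_contra! h
    refine hd (s + 1) (by omega) (by omega) ?_
    rw [hqs, Nat.ModEq, add_assoc, Nat.mul_add_mod]
  -- For A = {c, ..., c + q}, differences of kA and lA fill (k - l)c + [-lq, kq]. By Bézout (k - l)c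
  -- can be any multiple of δ modulo d; the first one above lq puts the range strictly between 0 and
  -- d because δ ≤ s.
  set t := l * q / δ + 1 with ht
  have ht1 : l * q < δ * t := by
    rw [ht, mul_add, mul_one]
    exact Nat.lt_mul_div_succ _ hδpos
  have ht2 : δ * t ≤ l * q + δ := by
    rw [ht, mul_add, mul_one]
    exact Nat.add_le_add_right (Nat.mul_div_le _ _) _
  obtain ⟨c, e, hce⟩ : ∃ c e : ℤ, ((k : ℤ) - l) * c = δ * t + d * e := by
    refine ⟨Int.gcdB d (k - l) * t, -(Int.gcdA d (k - l) * t), ?_⟩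
    have := Int.gcd_eq_gcd_ab (d : ℤ) (k - l)
    rw [hδ, deltaKL, this]
    ring
  set A : Finset (ZMod d) := (range (q + 1)).image fun i : ℕ => ((c + i : ℤ) : ZMod d) with hA
  have hkl : q ≤ (k + l) * q := Nat.le_mul_of_pos_left _ (by omega)
  have hAc : #A = q + 1 := by
    rw [hA, card_image_of_injOn, card_range]
    intro i hi j hj hij
    simp only [coe_range, Set.mem_Iio] at hi hj
    simp only [Int.cast_add, Int.cast_natCast, add_right_inj] at hij
    have := (ZMod.natCast_eq_natCast_iff' _ _ _).1 hij
    rwa [Nat.mod_eq_of_lt (by omega), Nat.mod_eq_of_lt (by omega)] at this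
  have hfree : IsSumFreeKL k l (A : Set (ZMod d)) := by
    rw [IsSumFreeKL, Set.eq_empty_iff_forall_notMem]
    rintro x ⟨hx1, hx2⟩
    obtain ⟨u, hu, hxu⟩ := hFoldSumset_zmod_interval hx1
    obtain ⟨v, hv, hxv⟩ := hFoldSumset_zmod_interval hx2
    have h1 : ((k * c + u : ℤ) : ZMod d) = ((l * c + v : ℤ) : ZMod d) := hxu ▸ hxv
    rw [ZMod.intCast_eq_intCast_iff_dvd_sub] at h1
    have h2 : (d : ℤ) ∣ δ * t + u - v := by
      have h3 : (δ * t + u - v : ℤ) = -((l * c + v) - (k * c + u)) - d * e := by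
        linear_combination -hce
      rw [h3]
      exact dvd_sub (dvd_neg.2 h1) (dvd_mul_right _ _)
    have hexp : (k + l) * q = k * q + l * q := by ring
    have h4 : (0 : ℤ) < δ * t + u - v := by
      have : (v : ℤ) < δ * t := by exact_mod_cast hv.trans_lt ht1
      omega
    have h5 : (δ * t + u - v : ℤ) < d := by
      have : δ * t + u < d := by omega
      have : ((δ * t + u : ℕ) : ℤ) < d := by exact_mod_cast this
      push_cast at this
      omega
    exact absurd (Int.le_of_dvd h4 h2) (not_le.2 h5)
  have h1 := card_le_maxSumFreeKL hfree
  rw [hAc] at h1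
  calc d ≤ (k + l) * (q + 1) := by rw [mul_add, mul_one]; omega
    _ ≤ _ := Nat.mul_le_mul_left _ h1

theorem exists_surjective_zmod_exponent (G : Type*) [AddCommGroup G] [Finite G] :
    ∃ φ : G →+ ZMod (AddMonoid.exponent G), Function.Surjective φ := by
  have hv : Monoid.exponent (Multiplicative G) = AddMonoid.exponent G :=
    Monoid.exponent_multiplicative
  have : NeZero (Monoid.exponent (Multiplicative G)) := ⟨Monoid.exponent_ne_zero_of_finite⟩
  -- G is isomorphic to its character group, so some character has order v; its image is a finite
  -- group of roots of unity, hence cyclic, of order v.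
  obtain ⟨e⟩ := CommGroup.monoidHom_mulEquiv_of_hasEnoughRootsOfUnity (Multiplicative G) ℂ
  obtain ⟨g, hg⟩ := Monoid.exists_orderOf_eq_exponent
    (Monoid.ExponentExists.of_finite (G := Multiplicative G))
  set χ := e.symm g with hχ
  have hχo : orderOf χ = Monoid.exponent (Multiplicative G) := by
    rw [hχ, MulEquiv.orderOf_eq, hg]
  have : Finite χ.range := Set.finite_range χ
  have hcyc : IsCyclic χ.range := inferInstance
  have hcard : Nat.card χ.range = AddMonoid.exponent G := by
    rw [← hv, ← hχo, ← IsCyclic.exponent_eq_card]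
    refine Nat.dvd_antisymm ?_ ?_
    · rw [hχo]
      exact MonoidHom.exponent_dvd χ.rangeRestrict_surjective
    · refine orderOf_dvd_of_pow_eq_one (MonoidHom.ext fun x => ?_)
      have := Monoid.pow_exponent_eq_one (χ.rangeRestrict x)
      exact congrArg Subtype.val this
  have hadd : IsAddCyclic (Additive χ.range) := inferInstance
  have hcard' : Nat.card (Additive χ.range) = AddMonoid.exponent G := hcard
  rw [← hcard']
  refine ⟨(zmodAddCyclicAddEquiv hadd).symm.toAddMonoidHom.comp
    (MonoidHom.toAdditiveRight χ.rangeRestrict), ?_⟩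
  exact (zmodAddCyclicAddEquiv hadd).symm.surjective.comp χ.rangeRestrict_surjective

theorem maxSumFreeKL_zmod_mul_le {k l d v : ℕ} [NeZero v] (hk : 0 < k) (hdv : d ∣ v) :
    maxSumFreeKL k l (ZMod d) * v ≤ maxSumFreeKL k l (ZMod v) * d := by
  have : NeZero d := ⟨fun h => NeZero.ne v (by rw [h] at hdv; exact zero_dvd_iff.1 hdv)⟩
  simpa using maxSumFreeKL_mul_card_le (l := l) hk (ZMod.castHom hdv (ZMod d)).toAddMonoidHom
    (ZMod.castHom_surjective hdv)

theorem theorem5 {G : Type*} [AddCommGroup G] [Finite G] (k l : ℕ)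
    (hk : 0 < k) (hl : 0 < l) (hkl : k ≠ l)
    (hd : ∃ d : ℕ, d ∣ AddMonoid.exponent G ∧
      ∀ j : ℕ, 1 ≤ j → j ≤ deltaKL k l d → ¬ d ≡ j [MOD (k + l)]) :
    (maxSumFreeKL k l G : ℚ) =
      (maxSumFreeKL k l (ZMod (AddMonoid.exponent G)) : ℚ) *
        ((Nat.card G : ℚ) / (AddMonoid.exponent G : ℚ)) := by
  classical
  cases nonempty_fintype G
  set v := AddMonoid.exponent G with hv
  have hv0 : v ≠ 0 := AddMonoid.exponent_ne_zero_of_finite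
  have : NeZero v := ⟨hv0⟩
  obtain ⟨d, hdv, hd⟩ := hd
  obtain ⟨φ, hφ⟩ := exists_surjective_zmod_exponent G
  have hge := maxSumFreeKL_mul_card_le (l := l) hk φ hφ
  rw [Nat.card_zmod] at hge
  have hle : maxSumFreeKL k l G * v ≤ maxSumFreeKL k l (ZMod v) * Nat.card G := by
    obtain ⟨B, hB, hBc⟩ := exists_card_eq_maxSumFreeKL hk l G
    rw [← hBc]
    by_cases hcard : Nat.card G < (k + l) * #B
    · obtain ⟨c, ψ, hψ, hfree⟩ := exists_zmod_isSumFreeKL_image hk hl hkl B hB hcard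
      have hcv : c ∣ v := by
        have := AddMonoidHom.exponent_dvd hψ
        rwa [ZMod.exponent] at this
      have : NeZero c := ⟨fun h => hv0 (by rw [h] at hcv; exact zero_dvd_iff.1 hcv)⟩
      have h1 := card_mul_card_le_card_image_mul ψ hψ B
      rw [← coe_image] at hfree
      have h2 := card_le_maxSumFreeKL hfree
      have h3 := maxSumFreeKL_zmod_mul_le (l := l) hk hcv
      rw [ZMod.card, ← Nat.card_eq_fintype_card] at h1
      refine le_of_mul_le_mul_right ?_ (NeZero.pos c)
      calc #B * v * c = #B * c * v := by ring
        _ ≤ #(B.image ψ) * Nat.card G * v := Nat.mul_le_mul_right _ h1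
        _ ≤ maxSumFreeKL k l (ZMod c) * Nat.card G * v :=
          Nat.mul_le_mul_right _ (Nat.mul_le_mul_right _ h2)
        _ = maxSumFreeKL k l (ZMod c) * v * Nat.card G := by ring
        _ ≤ maxSumFreeKL k l (ZMod v) * c * Nat.card G := Nat.mul_le_mul_right _ h3
        _ = _ := by ring
    -- Here #B is at most n/(k+l), and the interval in ℤ_d, lifted to ℤ_v, already reaches that
    -- density.
    · push Not at hcard
      have : NeZero d := ⟨fun h => hv0 (by rw [h] at hdv; exact zero_dvd_iff.1 hdv)⟩
      have h1 := le_mul_maxSumFreeKL_zmod hk hl hd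
      have h2 := maxSumFreeKL_zmod_mul_le (l := l) hk hdv
      refine le_of_mul_le_mul_right ?_ (Nat.mul_pos (show 0 < k + l by omega) (NeZero.pos d))
      calc #B * v * ((k + l) * d) = (k + l) * #B * v * d := by ring
        _ ≤ Nat.card G * v * ((k + l) * maxSumFreeKL k l (ZMod d)) :=
          Nat.mul_le_mul (Nat.mul_le_mul_right _ hcard) h1
        _ = Nat.card G * (k + l) * (maxSumFreeKL k l (ZMod d) * v) := by ring
        _ ≤ Nat.card G * (k + l) * (maxSumFreeKL k l (ZMod v) * d) := Nat.mul_le_mul_left _ h2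
        _ = _ := by ring
  have heq : (maxSumFreeKL k l G : ℚ) * v = maxSumFreeKL k l (ZMod v) * Nat.card G := by
    exact_mod_cast le_antisymm hle hge
  have hvq : (v : ℚ) ≠ 0 := by exact_mod_cast hv0
  field_simp
  exact heq

end Main
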